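/- **Conventions.** Let $\mathbf{C}$ be an essentially small category with pushouts. A *compact ordered space* is a compact topological space with a partial order that is closed in the product; morphisms are continuous order-preserving maps, and the category is $\mathbf{KOrd}$. A square of maps $a\colon A\to B$, $c\colon A\to C$, $b\colon B\to D$, $d\colon C\to D$ between ordered sets with $b\circ a\le d\circ c$ has the *interpolation property* if whenever $b(y)\le d(z)$ there is $x\in A$ with $y\le a(x)$ and $c(x)\le z$. An order-preserving map is *bounded* if direct images of up-sets are up-sets, and *lower semi-open* if direct images of open up-sets are open up-sets. A *$\mathbf{C}$-adic compact ordered space* is a functor $\mathcal S\colon \mathbf{C}^{\mathrm{op}}\to\mathbf{KOrd}$ that sends pushout squares to squares with interpolation and every morphism to a bounded map; it is *open* if it sends every morphism to a lower semi-open map. A *morphism* $\tau\colon\mathcal S_1\to\mathcal S_2$ of $\mathbf{C}$-adic compact ordered spaces is a natural transformation such that for all $\sigma\colon n\to m$, $y\in\mathcal S_2(m)$, $z\in\mathcal S_1(n)$ with $\mathcal S_2(\sigma)(y)\le\tau_n(z)$ there is $x\in\mathcal S_1(m)$ with $y\le\tau_m(x)$ and $\mathcal S_1(\sigma)(x)\le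 z$. It is *intuitionistic* if moreover each $\tau_n$ is bounded and, for all $\sigma\colon n\to m$, $y\in\mathcal S_1(n)$, $z\in\mathcal S_2(m)$ with $\tau_n(y)\le\mathcal S_2(\sigma)(z)$, there is $x\in\mathcal S_1(m)$ with $y\le\mathcal S_1(\sigma)(x)$ and $\tau_m(x)\le z$. Ind-objects of $\mathbf{C}$ are regarded as presheaves $X\colon\mathbf{C}^{\mathrm{op}}\to\mathbf{Set}$ that are filtered colimits of representables. Natural transformations $x\colon X\to\mathcal S$ (to the underlying presheaf of sets) are ordered pointwise. Let $\beta$ denote the Stone–Čech compactification of sets, with the discrete order on $\beta A$. Such an $x$ is a *model* of $\mathcal S$ if it is the restriction to $X$ of a natural transformation $\beta\circ X\to\mathcal S$ whose naturality squares have interpolation as in the definition of a morphism. It is an *$\omega$-saturated model* if for all $\sigma\colon n\to m$ in $\mathbf C$, $t\in\mathcal S(m)$ and $p\in X(n)$ with $\mathcal S(\sigma)(t)\le x_n(p)$ there is $q\in X(m)$ with $X(\sigma)(q)=p$ and $t\le x_m(q)$. **Proposition.** Let $\mathcal S,\mathcal P,\mathcal Q$ be $\mathbf{C}$-adic compact ordered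 spaces with $\mathcal S$ open, let $f\colon\mathcal S\to\mathcal P$ be an intuitionistic morphism and $g\colon\mathcal Q\to\mathcal P$ a morphism. Let $X$ be an ind-object of $\mathbf{C}$, and let $u\colon X\to\mathcal Q$ and $v\colon X\to\mathcal S$ be natural transformations with $f\circ v\le g\circ u$. Then there are an ind-object $X'$ of $\mathbf{C}$, a morphism $h\colon X\to X'$, and natural transformations $u'\colon X'\to\mathcal Q$ and $v'\colon X'\to\mathcal S$ such that $$g\circ u'=f\circ v',\qquad u'\circ h=u,\qquad v\le v'\circ h,$$ $v'$ is a model of $\mathcal S$, and $u'$ is an $\omega$-saturated model of $\mathcal Q$; if $\mathcal Q$ is open, then $u'$ is also a model of $\mathcal Q$. -/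

import Mathlib

open CategoryTheory Opposite

universe w v u

/-- A compact ordered space: a compact topological space with a partial order that is closed as a
subset of the product. -/
structure KOrd : Type (w + 1) where
  of ::
  carrier : Type w
  [topologicalSpace : TopologicalSpace carrier]
  [partialOrder : PartialOrder carrier]
  [compactSpace : CompactSpace carrier]
  [orderClosed : OrderClosedTopology carrier]

namespace KOrd

attribute [instance] topologicalSpace partialOrder compactSpace orderClosed

instance : CoeSort KOrd.{w} (Type w) := ⟨carrier⟩

/-- Morphisms of compact ordered spaces: continuous order-preserving functions. -/
@[ext]
structure Hom (X Y : KOrd.{w}) where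
  hom' : X →Co Y

instance : Category KOrd.{w} where
  Hom X Y := Hom X Y
  id X := ⟨ContinuousOrderHom.id X⟩
  comp f g := ⟨g.hom'.comp f.hom'⟩

instance : ConcreteCategory KOrd.{w} (fun X Y => X →Co Y) where
  hom f := f.hom'
  ofHom f := ⟨f⟩

end KOrd

namespace Polyadic

/-! ### Interpolation, bounded maps and semi-open maps -/

/-- The interpolation property of the lax square `u ∘ f ≤ v ∘ g`, where `f : A → B`, `g : A → C`,
`u : B → D`, `v : C → D`. -/
def Interpolation {A B C D : Type*} [LE B] [LE C] [LE D]
    (f : A → B) (g : A → C) (u : B → D) (v : C → D) : Prop :=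
  ∀ (b : B) (c : C), u b ≤ v c → ∃ a : A, b ≤ f a ∧ g a ≤ c

/-- A function between ordered sets is bounded if direct images of up-sets are up-sets. -/
def Bounded {A B : Type*} [LE A] [LE B] (f : A → B) : Prop :=
  ∀ U : Set A, IsUpperSet U → IsUpperSet (f '' U)

/-- A function is lower semi-open if direct images of open up-sets are open up-sets. -/
def LowerSemiOpen {A B : Type*} [TopologicalSpace A] [TopologicalSpace B] [LE A] [LE B]
    (f : A → B) : Prop :=
  ∀ U : Set A, IsOpen U → IsUpperSet U → IsOpen (f '' U) ∧ IsUpperSet (f '' U)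

/-! ### Polyadic compact ordered spaces and their morphisms -/

section Spaces

variable {C : Type u} [Category.{v} C]

/-- A presheaf of compact ordered spaces is a polyadic compact ordered space if it sends pushout
squares to squares with interpolation and morphisms to bounded maps. -/
structure IsPolyadic (S : Cᵒᵖ ⥤ KOrd.{w}) : Prop where
  interpolation : ∀ {n m k l : C} {f : n ⟶ m} {g : n ⟶ k} {inl : m ⟶ l} {inr : k ⟶ l},
    IsPushout f g inl inr →
      Interpolation (S.map inl.op) (S.map inr.op) (S.map f.op) (S.map g.op)
  bounded : ∀ {n m : C} (σ : n ⟶ m), Bounded (S.map σ.op)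

/-- The openness axiom for polyadic spaces. -/
def IsOpenSpace (S : Cᵒᵖ ⥤ KOrd.{w}) : Prop :=
  ∀ {n m : C} (σ : n ⟶ m), LowerSemiOpen (S.map σ.op)

/-- A natural transformation is a morphism of polyadic compact ordered spaces if its naturality
squares have interpolation, in the direction
`S₂(m) → S₂(n)` (lower path) `≤` `S₁(n) → S₂(n)` (upper path). -/
def IsPolyadicMorphism {S₁ S₂ : Cᵒᵖ ⥤ KOrd.{w}} (τ : S₁ ⟶ S₂) : Prop :=
  ∀ {n m : C} (σ : n ⟶ m),
    Interpolation (τ.app (op m)) (S₁.map σ.op) (S₂.map σ.op) (τ.app (op n))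

/-- A morphism of polyadic compact ordered spaces is intuitionistic if it is pointwise bounded and
its naturality squares have interpolation in both directions. -/
structure IsIntuitionistic {S₁ S₂ : Cᵒᵖ ⥤ KOrd.{w}} (τ : S₁ ⟶ S₂) : Prop where
  morphism : IsPolyadicMorphism τ
  bounded : ∀ n : C, Bounded (τ.app (op n))
  interpolation : ∀ {n m : C} (σ : n ⟶ m),
    Interpolation (S₁.map σ.op) (τ.app (op m)) (τ.app (op n)) (S₂.map σ.op)

end Spaces

/-! ### The Stone–Čech compactification of a set, with the discrete order -/

/-- The Stone–Čech compactification of the set `A`: the Stone space of ultrafilters on `A`, that is,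
the dual of the Boolean algebra of subsets of `A`. -/
def Beta (A : Type w) : Type w := Ultrafilter A

namespace Beta

instance (A : Type w) : TopologicalSpace (Beta A) := inferInstanceAs (TopologicalSpace (Ultrafilter A))

instance (A : Type w) : CompactSpace (Beta A) := inferInstanceAs (CompactSpace (Ultrafilter A))

instance (A : Type w) : T2Space (Beta A) := inferInstanceAs (T2Space (Ultrafilter A))

/-- The order is equality. -/
instance (A : Type w) : PartialOrder (Beta A) where
  le x y := x = y
  le_refl _ := rfl
  le_trans _ _ _ h h' := h.trans h'
  le_antisymm _ _ h _ := h

instance (A : Type w) : OrderClosedTopology (Beta A) where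
  isClosed_le' := isClosed_diagonal

/-- The image of an ultrafilter under a function. -/
def map {A B : Type w} (f : A → B) : Beta A →Co Beta B where
  toFun x := Ultrafilter.map f x
  monotone' x y h := congrArg (Ultrafilter.map f) (show x = y from h)
  continuous_toFun := by
    refine continuous_generateFrom_iff.2 ?_
    rintro _ ⟨s, rfl⟩
    exact ultrafilter_isOpen_basic (f ⁻¹' s)

/-- The inclusion of a set in its compactification, by principal ultrafilters. -/
def unit (A : Type w) (a : A) : Beta A := (pure a : Ultrafilter A)

end Beta

/-- The Stone–Čech compactification as a functor from sets to compact ordered spaces. -/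
def betaFunctor : Type w ⥤ KOrd.{w} where
  obj A := KOrd.of (Beta A)
  map f := ⟨Beta.map f⟩
  map_id A := by
    apply KOrd.Hom.ext
    ext x
    exact Ultrafilter.map_id x
  map_comp f g := by
    apply KOrd.Hom.ext
    ext x
    exact (Ultrafilter.map_map x _ _).symm

/-- The canonical natural transformation from the identity to the compactification functor. -/
def betaUnit : 𝟭 (Type w) ⟶ betaFunctor.{w} ⋙ forget KOrd.{w} where
  app A := TypeCat.ofHom (Beta.unit A)
  naturality A B f := by
    ext a
    exact (Ultrafilter.map_pure f a).symm

/-! ### Types, models and saturated models -/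

section Models

variable {C : Type u} [Category.{v} C]

/-- An `X`-type of `S`: a natural transformation from the presheaf of sets `X` to `S`. -/
abbrev XType (X : Cᵒᵖ ⥤ Type w) (S : Cᵒᵖ ⥤ KOrd.{w}) : Type _ :=
  X ⟶ S ⋙ forget KOrd.{w}

/-- The pointwise order on `X`-types. -/
def XType.Le {X : Cᵒᵖ ⥤ Type w} {S : Cᵒᵖ ⥤ KOrd.{w}} (x y : XType X S) : Prop :=
  ∀ (n : C) (p : X.obj (op n)),
    (show S.obj (op n) from x.app (op n) p) ≤ (show S.obj (op n) from y.app (op n) p)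

/-- The composite `X → S → P` of an `X`-type with a natural transformation. -/
def XType.push {X : Cᵒᵖ ⥤ Type w} {S P : Cᵒᵖ ⥤ KOrd.{w}} (x : XType X S) (τ : S ⟶ P) :
    XType X P :=
  x ≫ Functor.whiskerRight τ (forget KOrd.{w})

/-- The restriction to `X`, along `n ↦ (X(n) → βX(n))`, of a natural transformation `β ∘ X → S`. -/
def restrictBeta {X : Cᵒᵖ ⥤ Type w} {S : Cᵒᵖ ⥤ KOrd.{w}} (τ : X ⋙ betaFunctor ⟶ S) : XType X S :=
  Functor.whiskerLeft X betaUnit ≫ Functor.whiskerRight τ (forget KOrd.{w})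

/-- An `X`-type `x : X → S` is a model if it is the restriction of an `S`-structure on `X`, i.e. of
a morphism of polyadic compact ordered spaces `β ∘ X → S`. -/
def IsModel {X : Cᵒᵖ ⥤ Type w} {S : Cᵒᵖ ⥤ KOrd.{w}} (x : XType X S) : Prop :=
  ∃ τ : X ⋙ betaFunctor ⟶ S, IsPolyadicMorphism τ ∧ restrictBeta τ = x

/-- An `X`-type `x : X → S` is an `ω`-saturated model if its naturality squares have the
interpolation property, each set `X(n)` being ordered by equality. -/
def IsOmegaSaturatedModel {X : Cᵒᵖ ⥤ Type w} {S : Cᵒᵖ ⥤ KOrd.{w}} (x : XType X S) : Prop :=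
  ∀ {n m : C} (σ : n ⟶ m) (t : S.obj (op m)) (p : X.obj (op n)),
    S.map σ.op t ≤ (show S.obj (op n) from x.app (op n) p) →
      ∃ q : X.obj (op m),
        t ≤ (show S.obj (op m) from x.app (op m) q) ∧ X.map σ.op q = p

end Models

end Polyadic

/-! ### Evaluation of presheaves of compact ordered spaces and of types -/

namespace KOrd

variable {C : Type u} [Category.{v} C] (R : Cᵒᵖ ⥤ KOrd.{w})

/-! A pair `(u, v)` with `f v ≤ g u` is one type of the lax pullback `R` (`laxPullback`), whose
order is equality on the `Q`-component. Raising an `R`-type while extending `X` therefore fixes `u`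
and can only increase `v`, as the conclusion requires. It remains to realise enough elements of
fibres.

A demand above a point `p` along `σ` is a closed up-set of values. It is `Solvable` if it can be met
along every pushout of `σ`, whatever larger value has been reached meanwhile. Since demands are
up-sets, finitely many solvable ones can be attached one after another (`exists_attach`). Their
solution sets are compact, so a cofiltered limit of them is nonempty (`exists_compatible_family`),
and a small family is solved in one extension (`exists_solve_family`). Iterating `ω` times makes the
values climb; limits along a nonprincipal ultrafilter give a type on the union (`exists_saturated`).
Each value is then a limit of lower approximations whose solvable demands are all met over the same
point.

Three demands on a pair `(a, b)` are solvable: `f b = g a` (`solvable_eq`), `t ≤ a`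
(`solvable_le_fst`) and `t ≤ b` (`solvable_le_snd`). The `Q`-component of an approximation equals
that of its limit, so the first two pass to the limit and give commutativity and `ω`-saturation. The
`S`-component is only approximated. Openness of `S` makes the image of an open up-set open, so some
approximation already lies in it; this suffices for a model by `isModel_of_open`. -/

lemma map_comp_apply {n m k : C} (σ : n ⟶ m) (ρ : m ⟶ k) (s : R.obj (op k)) :
    R.map σ.op (R.map ρ.op s) = R.map (σ ≫ ρ).op s := by
  rw [op_comp, R.map_comp]; rfl

lemma map_id_apply {n : C} (s : R.obj (op n)) : R.map (𝟙 n).op s = s := by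
  rw [op_id, R.map_id]; rfl

lemma map_mono {n m : C} (σ : n ⟶ m) {s t : R.obj (op m)} (h : s ≤ t) :
    R.map σ.op s ≤ R.map σ.op t :=
  (R.map σ.op).hom'.monotone' h

lemma map_continuous {n m : C} (σ : n ⟶ m) :
    Continuous (fun s : R.obj (op m) => R.map σ.op s) :=
  (R.map σ.op).hom'.continuous_toFun

variable {R}

lemma app_mono {S : Cᵒᵖ ⥤ KOrd.{w}} (τ : R ⟶ S) {n : C} {s t : R.obj (op n)} (h : s ≤ t) :
    τ.app (op n) s ≤ τ.app (op n) t :=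
  (τ.app (op n)).hom'.monotone' h

lemma app_continuous {S : Cᵒᵖ ⥤ KOrd.{w}} (τ : R ⟶ S) (n : C) :
    Continuous (fun s : R.obj (op n) => τ.app (op n) s) :=
  (τ.app (op n)).hom'.continuous_toFun

lemma app_map {S : Cᵒᵖ ⥤ KOrd.{w}} (τ : R ⟶ S) {n m : C} (σ : n ⟶ m) (s : R.obj (op m)) :
    τ.app (op n) (R.map σ.op s) = S.map σ.op (τ.app (op m) s) :=
  congrArg (fun φ => φ.hom' s) (τ.naturality σ.op)

end KOrd

namespace Polyadic
variable {C : Type u} [Category.{v} C]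

/-- The value of an `X`-type at an element of `X`. -/
def XType.val {X : Cᵒᵖ ⥤ Type w} {R : Cᵒᵖ ⥤ KOrd.{w}} (r : XType X R) {n : C}
    (p : X.obj (op n)) : R.obj (op n) :=
  r.app (op n) p

section val
variable {X Y : Cᵒᵖ ⥤ Type w} {R S : Cᵒᵖ ⥤ KOrd.{w}} (r : XType X R)

lemma XType.val_map {n m : C} (σ : n ⟶ m) (p : X.obj (op m)) :
    r.val (X.map σ.op p) = R.map σ.op (r.val p) :=
  congrArg (fun φ => φ p) (r.naturality σ.op)

lemma XType.ext_val {r s : XType X R} (h : ∀ (n : C) (p : X.obj (op n)), r.val p = s.val p) :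
    r = s := by
  apply NatTrans.ext
  funext n
  ext p
  exact h n.unop p

lemma app_map_apply (h : X ⟶ Y) {n m : C} (σ : n ⟶ m) (p : X.obj (op m)) :
    h.app (op n) (X.map σ.op p) = Y.map σ.op (h.app (op m) p) :=
  congrArg (fun φ => φ p) (h.naturality σ.op)

/-- An `X`-type from a natural family of functions. -/
def XType.mk (val : ∀ n : C, X.obj (op n) → R.obj (op n))
    (nat : ∀ {n m : C} (σ : n ⟶ m) (p : X.obj (op m)),
      val n (X.map σ.op p) = R.map σ.op (val m p)) : XType X R where
  app n := TypeCat.ofHom (val n.unop)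
  naturality n m σ := by
    ext p
    exact nat σ.unop p

end val

end Polyadic

namespace Polyadic
variable {C : Type u} [Category.{v} C]

/-! ### Generic elements of presented ind-objects -/

section Presentation

open Limits

variable {X : Cᵒᵖ ⥤ Type v} (D : IndObjectPresentation X)

/-- The generic element of `X` at a vertex of a presentation. -/
def generic (i : D.I) : X.obj (op (D.F.obj i)) :=
  yonedaEquiv (D.ι.app i)

lemma ι_app_apply (i : D.I) {n : C} (a : n ⟶ D.F.obj i) :
    (D.ι.app i).app (op n) a = X.map a.op (generic D i) := by
  exact (map_yonedaEquiv (D.ι.app i) a).symm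

lemma generic_map {i j : D.I} (φ : i ⟶ j) :
    X.map (D.F.map φ).op (generic D j) = generic D i := by
  have h : yoneda.map (D.F.map φ) ≫ D.ι.app j = D.ι.app i :=
    (D.ι.naturality φ).trans (Category.comp_id _)
  exact (yonedaEquiv_naturality (D.ι.app j) (D.F.map φ)).trans (congrArg yonedaEquiv h)

lemma exists_eq_map_generic {n : C} (p : X.obj (op n)) :
    ∃ (i : D.I) (a : n ⟶ D.F.obj i), X.map a.op (generic D i) = p := by
  obtain ⟨i, a, rfl⟩ := Types.jointly_surjective_of_isColimit
    (isColimitOfPreserves ((evaluation Cᵒᵖ (Type v)).obj (op n)) D.isColimit) p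
  exact ⟨i, a, (ι_app_apply D i a).symm⟩

lemma exists_comp_map_eq {n : C} {i : D.I} (a b : n ⟶ D.F.obj i)
    (h : X.map a.op (generic D i) = X.map b.op (generic D i)) :
    ∃ (j : D.I) (φ : i ⟶ j), a ≫ D.F.map φ = b ≫ D.F.map φ := by
  rw [← ι_app_apply, ← ι_app_apply] at h
  exact (Types.FilteredColimit.isColimit_eq_iff'
    (isColimitOfPreserves ((evaluation Cᵒᵖ (Type v)).obj (op n)) D.isColimit) a b).1 h

/-- By Yoneda, a cocone under the diagram of representables is a compatible family of elements. -/
lemma exists_hom (Z : Cᵒᵖ ⥤ Type v) (z : ∀ i, Z.obj (op (D.F.obj i)))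
    (hz : ∀ {i j : D.I} (φ : i ⟶ j), Z.map (D.F.map φ).op (z j) = z i) :
    ∃ r : X ⟶ Z, ∀ i, r.app _ (generic D i) = z i := by
  let c : Cocone (D.F ⋙ yoneda) :=
    { pt := Z
      ι :=
        { app := fun i => yonedaEquiv.symm (z i)
          naturality := fun i j φ => by
            refine ((yonedaEquiv_symm_naturality_left (D.F.map φ) Z (z j)).trans ?_).trans
              (Category.comp_id _).symm
            exact congrArg yonedaEquiv.symm (hz φ) } }
  refine ⟨D.isColimit.desc c, fun i => ?_⟩
  have := congrArg yonedaEquiv (D.isColimit.fac c i)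
  rw [yonedaEquiv_comp] at this
  exact this.trans (Equiv.apply_symm_apply _ _)

/-- A filtered diagram has a colimit among ind-objects. -/
lemma exists_isIndObject_of_diagram {I : Type v} [SmallCategory I] [IsFiltered I] (L : I ⥤ C) :
    ∃ (X : Cᵒᵖ ⥤ Type v) (_ : IsIndObject X) (x : ∀ i, X.obj (op (L.obj i))),
      (∀ {i j : I} (φ : i ⟶ j), X.map (L.map φ).op (x j) = x i) ∧
      ∀ (Z : Cᵒᵖ ⥤ Type v) (z : ∀ i, Z.obj (op (L.obj i))),
        (∀ {i j : I} (φ : i ⟶ j), Z.map (L.map φ).op (z j) = z i) →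
          ∃ r : X ⟶ Z, ∀ i, r.app _ (x i) = z i := by
  let D : IndObjectPresentation (colimit (L ⋙ yoneda)) :=
    .ofCocone (colimit.cocone _) (colimit.isColimit (L ⋙ yoneda))
  exact ⟨_, .mk D, generic D, generic_map D, exists_hom D⟩

end Presentation
end Polyadic

/-! ### Models of open spaces -/

namespace KOrd

/-- In a compact ordered space, `y ≰ z` is witnessed by an open up-set around `y` that is disjoint
from a closed neighbourhood of `z`. -/
lemma exists_isOpen_isUpperSet_of_not_le (A : KOrd.{w}) {y z : A} (h : ¬ y ≤ z) :
    ∃ U : Set A, IsOpen U ∧ IsUpperSet U ∧ y ∈ U ∧ ∃ V ∈ nhds z, Disjoint U V := by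
  obtain ⟨V, hV, hVc, hVy⟩ := exists_mem_nhds_isClosed_subset
    ((isClosed_Ici (a := y)).isOpen_compl.mem_nhds h)
  -- The down-closure of `V` is the projection of a compact set of pairs.
  have hL : IsClosed {x : A | ∃ b ∈ V, x ≤ b} := by
    have : {x : A | ∃ b ∈ V, x ≤ b} =
        Prod.fst '' ({q : A × A | q.1 ≤ q.2} ∩ Prod.snd ⁻¹' V) := by
      ext x
      constructor
      · rintro ⟨b, hb, hx⟩
        exact ⟨(x, b), ⟨hx, hb⟩, rfl⟩
      · rintro ⟨⟨x, b⟩, ⟨hx, hb⟩, rfl⟩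
        exact ⟨b, hb, hx⟩
    rw [this]
    exact ((isClosed_le continuous_fst continuous_snd).inter
      (hVc.preimage continuous_snd)).isCompact.image continuous_fst |>.isClosed
  refine ⟨{x : A | ∃ b ∈ V, x ≤ b}ᶜ, hL.isOpen_compl, ?_, ?_, V, hV, ?_⟩
  · rintro a b hab ha ⟨c, hc, hbc⟩
    exact ha ⟨c, hc, hab.trans hbc⟩
  · rintro ⟨b, hb, hyb⟩
    exact hVy hb hyb
  · rw [Set.disjoint_left]
    exact fun x hx hxV => hx ⟨x, hxV, le_rfl⟩

end KOrd

namespace Polyadic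
variable {C : Type u} [Category.{v} C]

section Model

variable {X : Cᵒᵖ ⥤ Type w} {S : Cᵒᵖ ⥤ KOrd.{w}}

/-- The continuous extension of an `X`-type to the Stone–Čech compactification. -/
noncomputable def XType.extend (x : XType X S) : X ⋙ betaFunctor ⟶ S where
  app n := ⟨
    { toFun := Ultrafilter.extend (fun p : X.obj n => x.val (n := n.unop) p)
      monotone' := fun y z h => by rw [show y = z from h]
      continuous_toFun := continuous_ultrafilter_extend _ }⟩
  naturality n m σ := by
    apply KOrd.Hom.ext
    apply ContinuousOrderHom.ext
    refine congrFun (denseRange_pure.equalizer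
      ((continuous_ultrafilter_extend _).comp (Beta.map (X.map σ)).continuous_toFun)
      ((S.map σ).hom'.continuous_toFun.comp (continuous_ultrafilter_extend _)) ?_)
    funext p
    have h1 : Beta.map (X.map σ) (pure p : Ultrafilter _) = (pure (X.map σ p) : Ultrafilter _) :=
      Ultrafilter.map_pure _ _
    exact ((congrArg (Ultrafilter.extend _) h1).trans (ultrafilter_extend_pure _ _)).trans
      ((x.val_map σ.unop p).trans
        (congrArg (S.map σ).hom' (ultrafilter_extend_pure _ p).symm))

lemma restrictBeta_extend (x : XType X S) : restrictBeta x.extend = x :=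
  XType.ext_val fun _ p => ultrafilter_extend_pure _ p

/-- A type of an open space is a model when every open up-set that meets a fibre over one of its
values is inhabited by one of its values over that point. -/
theorem isModel_of_open (hS : IsOpenSpace S) (x : XType X S)
    (hx : ∀ {n m : C} (σ : n ⟶ m) (p : X.obj (op n)) (U : Set (S.obj (op m))), IsOpen U →
      IsUpperSet U → x.val p ∈ (fun s => S.map σ.op s) '' U →
        ∃ q : X.obj (op m), X.map σ.op q = p ∧ x.val q ∈ U) : IsModel x := by
  refine ⟨x.extend, ?_, restrictBeta_extend x⟩
  intro n m σ y z hyz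
  let z' : Ultrafilter (X.obj (op n)) := z
  have key : ∀ U : Set (S.obj (op m)), IsOpen U → IsUpperSet U → y ∈ U →
      ∀ A ∈ z',
        ∃ q : X.obj (op m), X.map σ.op q ∈ A ∧ x.val q ∈ U := by
    intro U hU hU' hy A hA
    obtain ⟨ho, hu⟩ := hS σ U hU hU'
    -- The image of `U` is an open up-set, so it contains the limit of `x` along `z'`, and hence
    -- `x.val p` for `z'`-almost every `p`.
    have hz : x.extend.app (op n) z ∈ (fun s => S.map σ.op s) '' U := hu hyz ⟨y, hy, rfl⟩
    have hev := ultrafilter_extend_eq_iff.1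
      (rfl : Ultrafilter.extend (fun p : X.obj (op n) => x.val p) z' = _) (ho.mem_nhds hz)
    obtain ⟨p, hpA, hp⟩ := Filter.nonempty_of_mem
      (Filter.inter_mem hA (show {p | x.val p ∈ _} ∈ z' from hev))
    obtain ⟨q, rfl, hq⟩ := hx σ p U hU hU' hp
    exact ⟨q, hpA, hq⟩
  -- Only up-set neighbourhoods of `y` are used: the ultrafilter is to have limit above `y`, not
  -- equal to it.
  let N : Filter (S.obj (op m)) :=
    { sets := {V | ∃ U ⊆ V, IsOpen U ∧ IsUpperSet U ∧ y ∈ U}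
      univ_sets := ⟨Set.univ, subset_rfl, isOpen_univ, isUpperSet_univ, trivial⟩
      sets_of_superset := fun ⟨U, h, h'⟩ hV => ⟨U, h.trans hV, h'⟩
      inter_sets := fun ⟨U, h, h1, h2, h3⟩ ⟨U', h', h1', h2', h3'⟩ =>
        ⟨U ∩ U', Set.inter_subset_inter h h', h1.inter h1', h2.inter h2', h3, h3'⟩ }
  let G : Filter (X.obj (op m)) :=
    Filter.comap (fun q => X.map σ.op q) z' ⊓ Filter.comap (fun q => x.val q) N
  have hG : G.NeBot := by
    rw [Filter.inf_neBot_iff]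
    rintro s ⟨A, hA, hs⟩ t ⟨V, ⟨U, hUV, hU, hU', hy⟩, ht⟩
    obtain ⟨q, hqA, hqU⟩ := key U hU hU' hy A hA
    exact ⟨q, hs hqA, ht (hUV hqU)⟩
  refine ⟨(Ultrafilter.of G : Ultrafilter _), ?_, ?_⟩
  · by_contra hle
    obtain ⟨U, hU, hU', hy, V, hV, hUV⟩ := KOrd.exists_isOpen_isUpperSet_of_not_le _ hle
    have h1 : {q | x.val q ∈ V} ∈ Ultrafilter.of G :=
      ultrafilter_extend_eq_iff.1
        (rfl : Ultrafilter.extend (fun p : X.obj (op m) => x.val p) (Ultrafilter.of G) = _) hV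
    have h2 : {q | x.val q ∈ U} ∈ Ultrafilter.of G :=
      Ultrafilter.of_le G (Filter.mem_inf_of_right
        (Filter.preimage_mem_comap ⟨U, subset_rfl, hU, hU', hy⟩))
    obtain ⟨q, hqV, hqU⟩ := Filter.nonempty_of_mem (Filter.inter_mem h1 h2)
    exact Set.disjoint_left.1 hUV hqU hqV
  · show Ultrafilter.map (fun q => X.map σ.op q) (Ultrafilter.of G) = z'
    apply Ultrafilter.eq_of_le
    exact (Filter.map_mono ((Ultrafilter.of_le G).trans inf_le_left)).trans Filter.map_comap_le

end Model
end Polyadic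

namespace Polyadic
variable {C : Type u} [Category.{v} C]

/-! ### Extension problems -/

/-- The condition `Z` on values at `m` can be met, along every pushout of `σ : n ⟶ m`, by extending
a given value up to the order, as soon as that value restricts to something above `c`. -/
def Solvable (R : Cᵒᵖ ⥤ KOrd.{w}) {n m : C} (σ : n ⟶ m) (c : R.obj (op n))
    (Z : Set (R.obj (op m))) : Prop :=
  ∀ ⦃k : C⦄ (a : n ⟶ k) (s : R.obj (op k)), c ≤ R.map a.op s →
    ∃ (l : C) (ι : k ⟶ l) (q : m ⟶ l), IsPushout a σ ι q ∧
      ∃ s' : R.obj (op l), s ≤ R.map ι.op s' ∧ R.map q.op s' ∈ Z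

/-- An extension problem: to find an element over `pt` along `hom` whose value satisfies `cond`. -/
structure Problem (X : Cᵒᵖ ⥤ Type w) (R : Cᵒᵖ ⥤ KOrd.{w}) where
  {src : C}
  {tgt : C}
  hom : src ⟶ tgt
  pt : X.obj (op src)
  cond : Set (R.obj (op tgt))

section Attach

variable {X : Cᵒᵖ ⥤ Type w} {R : Cᵒᵖ ⥤ KOrd.{w}} {T : Type w} (B : T → Problem X R)

/-- The object obtained by simultaneously pushing out the arrows of the problems in `G` along the
arrows `a`. -/
structure Attach (G : Finset T) {k : C} (a : ∀ j ∈ G, (B j).src ⟶ k) where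
  obj : C
  base : k ⟶ obj
  cell : ∀ j ∈ G, (B j).tgt ⟶ obj
  comm : ∀ j hj, a j hj ≫ base = (B j).hom ≫ cell j hj
  exists_desc : ∀ {l : C} (f : k ⟶ l) (g : ∀ j ∈ G, (B j).tgt ⟶ l),
    (∀ j hj, a j hj ≫ f = (B j).hom ≫ g j hj) →
      ∃ φ : obj ⟶ l, base ≫ φ = f ∧ ∀ j hj, cell j hj ≫ φ = g j hj
  hom_ext : ∀ {l : C} {φ ψ : obj ⟶ l}, base ≫ φ = base ≫ ψ →
    (∀ j hj, cell j hj ≫ φ = cell j hj ≫ ψ) → φ = ψ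

/-- Solutions of finitely many problems on the object which attaches all of them. -/
def Attach.solutions {B : T → Problem X R} {G : Finset T} {k : C} {a : ∀ j ∈ G, (B j).src ⟶ k}
    (A : Attach B G a) (s : R.obj (op k)) : Set (R.obj (op A.obj)) :=
  {s' | s ≤ R.map A.base.op s' ∧ ∀ j hj, R.map (A.cell j hj).op s' ∈ (B j).cond}

/-- Induction on `G`. Solvability allows any base point and any value above the prescribed one, so a
further problem can be solved on top of the previous solution. The earlier conditions survive the
increase because they are up-sets. -/
lemma exists_attach (r : XType X R) (hup : ∀ j, IsUpperSet (B j).cond)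
    (hsol : ∀ j, Solvable R (B j).hom (r.val (B j).pt) (B j).cond)
    (G : Finset T) {k : C} (a : ∀ j ∈ G, (B j).src ⟶ k) (s : R.obj (op k))
    (hs : ∀ j hj, r.val (B j).pt ≤ R.map (a j hj).op s) :
    ∃ A : Attach B G a, (A.solutions s).Nonempty := by
  classical
  induction G using Finset.induction_on with
  | empty =>
    refine ⟨⟨k, 𝟙 k, fun j hj => absurd hj (Finset.notMem_empty j),
      fun j hj => absurd hj (Finset.notMem_empty j), fun f g _ => ⟨f, Category.id_comp f,
        fun j hj => absurd hj (Finset.notMem_empty j)⟩, fun h _ => ?_⟩, s, ?_, ?_⟩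
    · simpa using h
    · rw [KOrd.map_id_apply]
    · exact fun j hj => absurd hj (Finset.notMem_empty j)
  | insert i G hi ih =>
    obtain ⟨A, s₁, hs₁, hZ⟩ := ih (fun j hj => a j (Finset.mem_insert_of_mem hj))
      (fun j hj => hs j _)
    have hiG := Finset.mem_insert_self i G
    obtain ⟨l, ι, q, sq, s₂, hs₂, hq⟩ := hsol i (a i hiG ≫ A.base) s₁ (by
      rw [← KOrd.map_comp_apply]
      exact (hs i hiG).trans (KOrd.map_mono R _ hs₁))
    have hG : ∀ {j}, j ∈ insert i G → ¬ j = i → j ∈ G := fun hj h =>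
      (Finset.mem_insert.1 hj).resolve_left h
    let c : ∀ j ∈ insert i G, (B j).tgt ⟶ l := fun j hj =>
      if h : j = i then eqToHom (by rw [h]) ≫ q else A.cell j (hG hj h) ≫ ι
    have ci : c i hiG = q := by simp [c]
    have cG : ∀ j (hj : j ∈ G), c j (Finset.mem_insert_of_mem hj) = A.cell j hj ≫ ι := by
      intro j hj
      have : ¬ j = i := fun h => hi (h ▸ hj)
      simp [c, this]
    have cases : ∀ {P : ∀ j, j ∈ insert i G → Prop}, P i hiG →
        (∀ j (hj : j ∈ G), P j (Finset.mem_insert_of_mem hj)) → ∀ j hj, P j hj := by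
      intro P h₁ h₂ j hj
      obtain rfl | h := Finset.mem_insert.1 hj
      · exact h₁
      · exact h₂ j h
    refine ⟨⟨l, A.base ≫ ι, c, ?_, ?_, ?_⟩, s₂, ?_, ?_⟩
    · refine cases ?_ fun j hj => ?_
      · rw [ci, ← sq.w, Category.assoc]
      · rw [cG, ← Category.assoc, A.comm j hj, Category.assoc]
    · intro l' f g hfg
      obtain ⟨φ, hφ, hφ'⟩ := A.exists_desc f (fun j hj => g j (Finset.mem_insert_of_mem hj))
        (fun j hj => hfg j _)
      have w : (a i hiG ≫ A.base) ≫ φ = (B i).hom ≫ g i hiG := by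
        rw [Category.assoc, hφ, hfg]
      refine ⟨sq.desc φ (g i hiG) w, ?_, cases ?_ fun j hj => ?_⟩
      · rw [Category.assoc, sq.inl_desc, hφ]
      · rw [ci, sq.inr_desc]
      · rw [cG j hj, Category.assoc, sq.inl_desc, hφ']
    · intro l' φ ψ h h'
      refine sq.hom_ext (A.hom_ext (by simpa using h) fun j hj => ?_) ?_
      · have := h' j (Finset.mem_insert_of_mem hj)
        rwa [cG, Category.assoc, Category.assoc] at this
      · have := h' i hiG
        rwa [ci] at this
    · show s ≤ R.map (A.base ≫ ι).op s₂
      rw [← KOrd.map_comp_apply]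
      exact hs₁.trans (KOrd.map_mono R _ hs₂)
    · refine cases ?_ fun j hj => ?_
      · show R.map (c i hiG).op s₂ ∈ _
        rw [ci]
        exact hq
      · show R.map (c j (Finset.mem_insert_of_mem hj)).op s₂ ∈ _
        rw [cG j hj, ← KOrd.map_comp_apply]
        exact hup j (KOrd.map_mono R _ hs₂) (hZ j hj)

lemma Attach.isClosed_solutions {B : T → Problem X R} (hcl : ∀ j, IsClosed (B j).cond)
    {G : Finset T} {k : C} {a : ∀ j ∈ G, (B j).src ⟶ k}
    (A : Attach B G a) (s : R.obj (op k)) : IsClosed (A.solutions s) := by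
  have : A.solutions s = (fun s' => R.map A.base.op s') ⁻¹' Set.Ici s ∩
      ⋂ j, ⋂ hj, (fun s' => R.map (A.cell j hj).op s') ⁻¹' (B j).cond := by
    ext s'
    simp [Attach.solutions]
  rw [this]
  exact (isClosed_Ici.preimage (KOrd.map_continuous R _)).inter
    (isClosed_iInter fun j => isClosed_iInter fun hj =>
      (hcl j).preimage (KOrd.map_continuous R _))

end Attach

/-! ### The filtered category of finite attachments -/

section Stages

open Limits

variable {X : Cᵒᵖ ⥤ Type v} {R : Cᵒᵖ ⥤ KOrd.{v}} {T : Type v} (B : T → Problem X R)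
  (D : IndObjectPresentation X)

/-- A vertex of a presentation of `X` at which finitely many problems can be attached. -/
structure Stage where
  idx : D.I
  probs : Finset T
  arr : ∀ j ∈ probs, (B j).src ⟶ D.F.obj idx
  map_arr : ∀ j hj, X.map (arr j hj).op (generic D idx) = (B j).pt

variable {B D}

/-- Morphisms of stages are morphisms of vertices that preserve the attaching arrows. -/
@[ext]
structure Stage.Hom (κ μ : Stage B D) where
  hom : κ.idx ⟶ μ.idx
  sub : κ.probs ⊆ μ.probs
  comm : ∀ j hj, κ.arr j hj ≫ D.F.map hom = μ.arr j (sub hj)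

instance : Category (Stage B D) where
  Hom := Stage.Hom
  id κ := ⟨𝟙 _, subset_rfl, by simp⟩
  comp f g := ⟨f.hom ≫ g.hom, f.sub.trans g.sub, fun j hj => by
    rw [D.F.map_comp, ← Category.assoc, f.comm, g.comm]⟩
  id_comp f := Stage.Hom.ext (Category.id_comp f.hom)
  comp_id f := Stage.Hom.ext (Category.comp_id f.hom)
  assoc f g h := Stage.Hom.ext (Category.assoc f.hom g.hom h.hom)

/-- The stage with no problems attached. -/
def Stage.bare (i : D.I) : Stage B D :=
  ⟨i, ∅, fun j hj => absurd hj (Finset.notMem_empty j),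
    fun j hj => absurd hj (Finset.notMem_empty j)⟩

/-- The morphism of bare stages induced by a morphism of vertices. -/
def Stage.bareMap {i j : D.I} (φ : i ⟶ j) : (Stage.bare i : Stage B D) ⟶ Stage.bare j :=
  ⟨φ, subset_rfl, fun j hj => absurd hj (Finset.notMem_empty j)⟩

/-- Arrows that agree as elements of the filtered colimit `X` agree at a later vertex; finitely many
pairs need only finitely many such steps. -/
lemma exists_equalize (i : D.I) (G : Finset T) (a b : ∀ j ∈ G, (B j).src ⟶ D.F.obj i)
    (h : ∀ j hj, X.map (a j hj).op (generic D i) = X.map (b j hj).op (generic D i)) :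
    ∃ (i' : D.I) (φ : i ⟶ i'), ∀ j hj, a j hj ≫ D.F.map φ = b j hj ≫ D.F.map φ := by
  classical
  induction G using Finset.induction_on with
  | empty => exact ⟨i, 𝟙 i, fun j hj => absurd hj (Finset.notMem_empty j)⟩
  | insert j₀ G _ ih =>
    obtain ⟨i₁, φ, hφ⟩ := ih (fun j hj => a j (Finset.mem_insert_of_mem hj))
      (fun j hj => b j (Finset.mem_insert_of_mem hj)) (fun j hj => h j _)
    obtain ⟨i₂, ψ, hψ⟩ := exists_comp_map_eq D
      (a j₀ (Finset.mem_insert_self _ _) ≫ D.F.map φ)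
      (b j₀ (Finset.mem_insert_self _ _) ≫ D.F.map φ) (by
        have := h j₀ (Finset.mem_insert_self _ _)
        rw [← generic_map D φ] at this
        simpa using this)
    refine ⟨i₂, φ ≫ ψ, fun j hj => ?_⟩
    rw [D.F.map_comp]
    obtain rfl | hjG := Finset.mem_insert.1 hj
    · simpa using hψ
    · rw [← Category.assoc, ← Category.assoc]
      exact congrArg (· ≫ D.F.map ψ) (hφ j hjG)

instance : IsFiltered (Stage B D) where
  nonempty := ⟨Stage.bare (IsFiltered.nonempty (C := D.I)).some⟩
  cocone_objs κ μ := by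
    classical
    let i := IsFiltered.max κ.idx μ.idx
    let f : κ.idx ⟶ i := IsFiltered.leftToMax _ _
    let g : μ.idx ⟶ i := IsFiltered.rightToMax _ _
    -- A problem common to both stages may be attached by different arrows; these name the same
    -- point of `X`, so they become equal further on.
    obtain ⟨i', φ, hφ⟩ := exists_equalize i (κ.probs ∩ μ.probs)
      (fun j hj => κ.arr j (Finset.mem_inter.1 hj).1 ≫ D.F.map f)
      (fun j hj => μ.arr j (Finset.mem_inter.1 hj).2 ≫ D.F.map g) (fun j hj => by
        have h₁ := κ.map_arr j (Finset.mem_inter.1 hj).1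
        have h₂ := μ.map_arr j (Finset.mem_inter.1 hj).2
        rw [← generic_map D f] at h₁
        rw [← generic_map D g] at h₂
        simpa using h₁.trans h₂.symm)
    have hμ : ∀ {j}, j ∈ κ.probs ∪ μ.probs → j ∉ κ.probs → j ∈ μ.probs := fun hj h =>
      (Finset.mem_union.1 hj).resolve_left h
    refine ⟨⟨i', κ.probs ∪ μ.probs, fun j hj =>
      if h : j ∈ κ.probs then κ.arr j h ≫ D.F.map (f ≫ φ) else μ.arr j (hμ hj h) ≫ D.F.map (g ≫ φ),
      fun j hj => ?_⟩, ⟨f ≫ φ, Finset.subset_union_left, fun j hj => ?_⟩,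
      ⟨g ≫ φ, Finset.subset_union_right, fun j hj => ?_⟩, trivial⟩
    · split_ifs with h
      · have h₁ := κ.map_arr j h
        rw [← generic_map D (f ≫ φ)] at h₁
        simpa using h₁
      · have h₁ := μ.map_arr j (hμ hj h)
        rw [← generic_map D (g ≫ φ)] at h₁
        simpa using h₁
    · simp [hj]
    · by_cases h : j ∈ κ.probs
      · simpa [h] using (hφ j (Finset.mem_inter.2 ⟨h, hj⟩)).symm
      · simp [h]
  cocone_maps κ μ f g := by
    refine ⟨⟨IsFiltered.coeq f.hom g.hom, μ.probs,
      fun j hj => μ.arr j hj ≫ D.F.map (IsFiltered.coeqHom f.hom g.hom), fun j hj => ?_⟩,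
      ⟨IsFiltered.coeqHom f.hom g.hom, subset_rfl, fun j hj => rfl⟩, ?_⟩
    · have h₁ := μ.map_arr j hj
      rw [← generic_map D (IsFiltered.coeqHom f.hom g.hom)] at h₁
      simpa using h₁
    · exact Stage.Hom.ext (IsFiltered.coeq_condition f.hom g.hom)

lemma Attach.exists_map {κ μ : Stage B D} (A : Attach B κ.probs κ.arr)
    (A' : Attach B μ.probs μ.arr) (f : κ ⟶ μ) :
    ∃ φ : A.obj ⟶ A'.obj, A.base ≫ φ = D.F.map f.hom ≫ A'.base ∧
      ∀ j hj, A.cell j hj ≫ φ = A'.cell j (f.sub hj) :=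
  A.exists_desc _ _ fun j hj => by rw [← Category.assoc, f.comm, A'.comm]

/-- The map between attached objects that is induced by a morphism of stages. -/
noncomputable def attachMap (A : ∀ κ : Stage B D, Attach B κ.probs κ.arr) {κ μ : Stage B D}
    (f : κ ⟶ μ) : (A κ).obj ⟶ (A μ).obj :=
  ((A κ).exists_map (A μ) f).choose

lemma base_attachMap (A : ∀ κ : Stage B D, Attach B κ.probs κ.arr) {κ μ : Stage B D}
    (f : κ ⟶ μ) : (A κ).base ≫ attachMap A f = D.F.map f.hom ≫ (A μ).base :=
  ((A κ).exists_map (A μ) f).choose_spec.1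

lemma cell_attachMap (A : ∀ κ : Stage B D, Attach B κ.probs κ.arr) {κ μ : Stage B D}
    (f : κ ⟶ μ) (j : T) (hj : j ∈ κ.probs) :
    (A κ).cell j hj ≫ attachMap A f = (A μ).cell j (f.sub hj) :=
  ((A κ).exists_map (A μ) f).choose_spec.2 j hj

/-- The chosen maps are functorial because a map out of an attached object is determined on the base
and the cells. -/
lemma attachMap_id (A : ∀ κ : Stage B D, Attach B κ.probs κ.arr) (κ : Stage B D) :
    attachMap A (𝟙 κ) = 𝟙 (A κ).obj := by
  refine (A κ).hom_ext ((base_attachMap A _).trans ?_) fun j hj =>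
    (cell_attachMap A _ j hj).trans (Category.comp_id _).symm
  rw [show (𝟙 κ : κ ⟶ κ).hom = 𝟙 κ.idx from rfl]
  simp

lemma attachMap_comp (A : ∀ κ : Stage B D, Attach B κ.probs κ.arr) {κ μ ν : Stage B D}
    (f : κ ⟶ μ) (g : μ ⟶ ν) : attachMap A (f ≫ g) = attachMap A f ≫ attachMap A g := by
  refine (A κ).hom_ext ((base_attachMap A _).trans ?_) fun j hj =>
    (cell_attachMap A _ j hj).trans ?_
  · rw [← Category.assoc, base_attachMap, Category.assoc, base_attachMap,
      show (f ≫ g).hom = f.hom ≫ g.hom from rfl, D.F.map_comp, Category.assoc]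
  · rw [← Category.assoc, cell_attachMap, cell_attachMap]

/-- The diagram of attached objects. -/
noncomputable def attachDiagram (A : ∀ κ : Stage B D, Attach B κ.probs κ.arr) :
    Stage B D ⥤ C where
  obj κ := (A κ).obj
  map f := attachMap A f
  map_id κ := attachMap_id A κ
  map_comp f g := attachMap_comp A f g

end Stages

end Polyadic

/-! ### Simultaneous solution by compactness -/

namespace Polyadic
variable {C : Type u} [Category.{v} C]

section Step

open Limits

variable {X : Cᵒᵖ ⥤ Type v} {R : Cᵒᵖ ⥤ KOrd.{v}} {T : Type v}

/-- Solutions restrict to solutions along morphisms of stages, so the solution sets form a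
cofiltered system of nonempty compact Hausdorff spaces, which has a point in its limit. -/
lemma exists_compatible_family {B : T → Problem X R} {D : IndObjectPresentation X} (r : XType X R)
    (hcl : ∀ j, IsClosed (B j).cond) (A : ∀ κ : Stage B D, Attach B κ.probs κ.arr)
    (hA : ∀ κ, ((A κ).solutions (r.val (generic D κ.idx))).Nonempty) :
    ∃ s : ∀ κ, R.obj (op (A κ).obj), (∀ κ, s κ ∈ (A κ).solutions (r.val (generic D κ.idx))) ∧
      ∀ {κ μ : Stage B D} (f : κ ⟶ μ), R.map (attachMap A f).op (s μ) = s κ := by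
  have hmap : ∀ {κ μ : Stage B D} (f : κ ⟶ μ) (s : R.obj (op (A μ).obj)),
      s ∈ (A μ).solutions (r.val (generic D μ.idx)) →
        R.map (attachMap A f).op s ∈ (A κ).solutions (r.val (generic D κ.idx)) := by
    rintro κ μ f s ⟨h, h'⟩
    refine ⟨?_, fun j hj => ?_⟩
    · refine le_of_le_of_eq ?_ (KOrd.map_comp_apply R (A κ).base (attachMap A f) s).symm
      rw [base_attachMap, ← KOrd.map_comp_apply, ← generic_map D f.hom, r.val_map]
      exact KOrd.map_mono R _ h
    · have := h' j (f.sub hj)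
      rw [← cell_attachMap A f j hj, ← KOrd.map_comp_apply] at this
      exact this
  let F : (Stage B D)ᵒᵖ ⥤ TopCat.{v} :=
    { obj := fun κ => TopCat.of ((A κ.unop).solutions (r.val (generic D κ.unop.idx)))
      map := fun f => TopCat.ofHom
        ⟨fun s => ⟨R.map (attachMap A f.unop).op s.1, hmap f.unop s.1 s.2⟩,
          ((KOrd.map_continuous R _).comp continuous_subtype_val).subtype_mk _⟩
      map_id := fun κ => by
        ext s
        show R.map (attachMap A (𝟙 κ.unop)).op s.1 = s.1
        rw [attachMap_id, KOrd.map_id_apply]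
      map_comp := fun f g => by
        ext s
        show R.map (attachMap A (g.unop ≫ f.unop)).op s.1 =
          R.map (attachMap A g.unop).op (R.map (attachMap A f.unop).op s.1)
        rw [attachMap_comp, KOrd.map_comp_apply] }
  have : ∀ κ, Nonempty (F.obj κ) := fun κ => (hA κ.unop).to_subtype
  have : ∀ κ, CompactSpace (F.obj κ) := fun κ =>
    isCompact_iff_compactSpace.1 ((A κ.unop).isClosed_solutions hcl _).isCompact
  have : ∀ κ, T2Space (F.obj κ) := fun κ =>
    inferInstanceAs (T2Space ((A κ.unop).solutions (r.val (generic D κ.unop.idx))))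
  obtain ⟨⟨s, hs⟩⟩ := TopCat.nonempty_limitCone_of_compact_t2_cofiltered_system.{v} F
  exact ⟨fun κ => (s (op κ)).1, fun κ => (s (op κ)).2,
    fun f => congrArg Subtype.val (hs f.op)⟩

/-- A small family of solvable problems on an ind-object can be solved simultaneously in an
extension, at the cost of increasing the given type. -/
theorem exists_solve_family (hX : IsIndObject X) (r : XType X R) (B : T → Problem X R)
    (hcl : ∀ j, IsClosed (B j).cond) (hup : ∀ j, IsUpperSet (B j).cond)
    (hsol : ∀ j, Solvable R (B j).hom (r.val (B j).pt) (B j).cond) :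
    ∃ (X' : Cᵒᵖ ⥤ Type v) (_ : IsIndObject X') (h : X ⟶ X') (r' : XType X' R),
      (∀ {n : C} (p : X.obj (op n)), r.val p ≤ r'.val (h.app (op n) p)) ∧
      ∀ j, ∃ q : X'.obj (op (B j).tgt),
        X'.map (B j).hom.op q = h.app _ (B j).pt ∧ r'.val q ∈ (B j).cond := by
  let D := hX.presentation
  choose A hA using fun κ : Stage B D => exists_attach B r hup hsol κ.probs κ.arr
    (r.val (generic D κ.idx)) fun j hj => by rw [← r.val_map, κ.map_arr]
  obtain ⟨s, hs, hcompat⟩ := exists_compatible_family r hcl A hA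
  obtain ⟨X', hX', x, hx, hdesc⟩ : ∃ (X' : Cᵒᵖ ⥤ Type v) (_ : IsIndObject X')
      (x : ∀ κ, X'.obj (op (A κ).obj)),
      (∀ {κ μ : Stage B D} (f : κ ⟶ μ), X'.map (attachMap A f).op (x μ) = x κ) ∧
      ∀ (Z : Cᵒᵖ ⥤ Type v) (z : ∀ κ, Z.obj (op (A κ).obj)),
        (∀ {κ μ : Stage B D} (f : κ ⟶ μ), Z.map (attachMap A f).op (z μ) = z κ) →
          ∃ r : X' ⟶ Z, ∀ κ, r.app _ (x κ) = z κ :=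
    exists_isIndObject_of_diagram (attachDiagram A)
  obtain ⟨r', hr'⟩ : ∃ r' : XType X' R, ∀ κ : Stage B D, r'.val (x κ) = s κ :=
    hdesc (R ⋙ forget KOrd.{v}) s hcompat
  have hbase : ∀ {κ μ : Stage B D} (f : κ ⟶ μ), X'.map (A κ).base.op (x κ) =
      X'.map (D.F.map f.hom).op (X'.map (A μ).base.op (x μ)) := by
    intro κ μ f
    rw [← hx f, ← Functor.map_comp_apply, ← Functor.map_comp_apply, ← op_comp, ← op_comp,
      base_attachMap]
  -- The bare stages are a copy of the presentation of `X`, and their bases define the map to the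
  -- colimit.
  obtain ⟨h, hh⟩ := exists_hom D X'
    (fun i => X'.map (A (Stage.bare i)).base.op (x (Stage.bare i)))
    fun φ => (hbase (Stage.bareMap φ)).symm
  have hgen : ∀ κ : Stage B D,
      h.app _ (generic D κ.idx) = X'.map (A κ).base.op (x κ) := by
    intro κ
    let f : Stage.bare κ.idx ⟶ κ :=
      ⟨𝟙 κ.idx, Finset.empty_subset _, fun j hj => absurd hj (Finset.notMem_empty j)⟩
    refine (hh κ.idx).trans ((hbase f).trans ?_)
    have hid : ∀ {i : D.I} (z : X'.obj (op (D.F.obj i))), X'.map (D.F.map (𝟙 i)).op z = z := by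
      simp
    exact hid _
  have hle : ∀ κ : Stage B D,
      r.val (generic D κ.idx) ≤ r'.val (X'.map (A κ).base.op (x κ)) := by
    intro κ
    rw [r'.val_map, hr']
    exact (hs κ).1
  refine ⟨X', hX', h, r', ?_, ?_⟩
  · intro n p
    obtain ⟨i, a, rfl⟩ := exists_eq_map_generic D p
    rw [app_map_apply, r.val_map, r'.val_map]
    refine KOrd.map_mono R a ((hle (Stage.bare i)).trans_eq ?_)
    exact congrArg r'.val (hgen (Stage.bare i)).symm
  · intro j
    -- The point of a problem is represented at some vertex, where that problem alone can be
    -- attached.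
    obtain ⟨κ, hj⟩ : ∃ κ : Stage B D, j ∈ κ.probs := by
      obtain ⟨i, a, ha⟩ := exists_eq_map_generic D (B j).pt
      refine ⟨⟨i, {j}, fun j' hj' => eqToHom (by rw [Finset.mem_singleton.1 hj']) ≫ a,
        fun j' hj' => ?_⟩, Finset.mem_singleton_self j⟩
      obtain rfl := Finset.mem_singleton.1 hj'
      simpa using ha
    refine ⟨X'.map ((A κ).cell j hj).op (x κ), ?_, ?_⟩
    · rw [← κ.map_arr j hj, app_map_apply, hgen, ← Functor.map_comp_apply,
        ← Functor.map_comp_apply, ← op_comp, ← op_comp, (A κ).comm j hj]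
    · rw [r'.val_map, hr']
      exact (hs κ).2 j hj

end Step
end Polyadic

/-! ### Iteration and ultrafilter limits -/

namespace Polyadic
variable {C : Type u} [Category.{v} C]

section Transport

/-- This permits problems to be indexed by a small skeleton of `C`. -/
lemma Solvable.of_iso {R : Cᵒᵖ ⥤ KOrd.{w}} {n m n' m' : C} {σ : n ⟶ m} {c : R.obj (op n)}
    {Z : Set (R.obj (op m))} (h : Solvable R σ c Z) (α : n ≅ n') (β : m ≅ m') :
    Solvable R (α.inv ≫ σ ≫ β.hom) (R.map α.inv.op c) {z | R.map β.hom.op z ∈ Z} := by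
  intro k a s hs
  obtain ⟨l, ι, q, sq, s', h₁, h₂⟩ := h (α.hom ≫ a) s (by
    have := KOrd.map_mono R α.hom hs
    rwa [KOrd.map_comp_apply, KOrd.map_comp_apply, α.hom_inv_id, KOrd.map_id_apply] at this)
  refine ⟨l, ι, β.inv ≫ q, ?_, s', h₁, ?_⟩
  · exact IsPushout.of_iso sq α (Iso.refl _) β (Iso.refl _) (by simp) (by simp) (by simp) (by simp)
  · show R.map β.hom.op (R.map (β.inv ≫ q).op s') ∈ Z
    rw [KOrd.map_comp_apply, β.hom_inv_id_assoc]
    exact h₂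

end Transport

section Chain

open Limits

variable {R : Cᵒᵖ ⥤ KOrd.{v}}

/-- All solvable problems on an ind-object can be solved in a single extension. -/
theorem exists_solve_all [EssentiallySmall.{v} C] {X : Cᵒᵖ ⥤ Type v} (hX : IsIndObject X)
    (r : XType X R) :
    ∃ (X' : Cᵒᵖ ⥤ Type v) (_ : IsIndObject X') (h : X ⟶ X') (r' : XType X' R),
      (∀ {n : C} (p : X.obj (op n)), r.val p ≤ r'.val (h.app (op n) p)) ∧
      ∀ {n m : C} (σ : n ⟶ m) (p : X.obj (op n)) (Z : Set (R.obj (op m))), IsClosed Z →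
        IsUpperSet Z → Solvable R σ (r.val p) Z →
          ∃ q : X'.obj (op m), X'.map σ.op q = h.app _ p ∧ r'.val q ∈ Z := by
  let e := equivSmallModel.{v} C
  -- Restricting sources and targets to the small model keeps the family of problems in `Type v`.
  let T : Type v := Σ (n m : SmallModel.{v} C), { B : (e.inverse.obj n ⟶ e.inverse.obj m) ×
    X.obj (op (e.inverse.obj n)) × Set (R.obj (op (e.inverse.obj m))) //
      IsClosed B.2.2 ∧ IsUpperSet B.2.2 ∧ Solvable R B.1 (r.val B.2.1) B.2.2 }
  obtain ⟨X', hX', h, r', hr, hsol⟩ := exists_solve_family hX r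
    (fun B : T => ⟨B.2.2.1.1, B.2.2.1.2.1, B.2.2.1.2.2⟩) (fun B => B.2.2.2.1)
    (fun B => B.2.2.2.2.1) (fun B => B.2.2.2.2.2)
  refine ⟨X', hX', h, r', hr, ?_⟩
  intro n m σ p Z hZ hZ' hs
  obtain ⟨α⟩ : Nonempty (n ≅ e.inverse.obj (e.functor.obj n)) := ⟨e.unitIso.app n⟩
  obtain ⟨β⟩ : Nonempty (m ≅ e.inverse.obj (e.functor.obj m)) := ⟨e.unitIso.app m⟩
  have hs' := hs.of_iso α β
  rw [← r.val_map] at hs'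
  obtain ⟨q, hq, hqZ⟩ := hsol ⟨e.functor.obj n, e.functor.obj m,
    ⟨α.inv ≫ σ ≫ β.hom, X.map α.inv.op p, {z | R.map β.hom.op z ∈ Z}⟩,
    hZ.preimage (KOrd.map_continuous R _), fun _ _ hab ha => hZ' (KOrd.map_mono R _ hab) ha, hs'⟩
  refine ⟨X'.map β.hom.op q, ?_, ?_⟩
  · have h₁ : X'.map (α.inv ≫ σ ≫ β.hom).op q = h.app _ (X.map α.inv.op p) := hq
    have h₂ : X'.map (σ ≫ β.hom).op q = X'.map α.hom.op (X'.map (α.inv ≫ σ ≫ β.hom).op q) := by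
      rw [← Functor.map_comp_apply, ← op_comp, α.hom_inv_id_assoc]
    rw [← Functor.map_comp_apply, ← op_comp, h₂, h₁, ← app_map_apply, ← Functor.map_comp_apply,
      ← op_comp, α.hom_inv_id, op_id, Functor.map_id_apply]
  · rw [r'.val_map]
    exact hqZ

/-- A sequence of ind-objects has a colimit among ind-objects. -/
lemma exists_isIndObject_of_sequence (F : ℕ ⥤ Cᵒᵖ ⥤ Type v) (hF : ∀ i, IsIndObject (F.obj i)) :
    ∃ (X : Cᵒᵖ ⥤ Type v) (_ : IsIndObject X) (ι : ∀ i, F.obj i ⟶ X),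
      (∀ {i j : ℕ} (φ : i ⟶ j), F.map φ ≫ ι j = ι i) ∧
      (∀ {n : C} (p : X.obj (op n)), ∃ (i : ℕ) (p' : (F.obj i).obj (op n)),
        (ι i).app _ p' = p) ∧
      ∀ (Z : Cᵒᵖ ⥤ Type v) (z : ∀ i, F.obj i ⟶ Z),
        (∀ {i j : ℕ} (φ : i ⟶ j), F.map φ ≫ z j = z i) →
          ∃ r : X ⟶ Z, ∀ i, ι i ≫ r = z i := by
  let G : ULift.{v} ℕ ⥤ Cᵒᵖ ⥤ Type v :=
    Monotone.functor (f := (ULift.down : ULift.{v} ℕ → ℕ)) (fun _ _ h => h) ⋙ F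
  refine ⟨colimit G, isIndObject_colimit _ G fun i => hF i.down, fun i => colimit.ι G ⟨i⟩,
    ?_, ?_, ?_⟩
  · intro i j φ
    exact colimit.w G (homOfLE (show i ≤ j from leOfHom φ) : (⟨i⟩ : ULift.{v} ℕ) ⟶ ⟨j⟩)
  · intro n p
    obtain ⟨i, p', rfl⟩ := Types.jointly_surjective_of_isColimit
      (isColimitOfPreserves ((evaluation Cᵒᵖ (Type v)).obj (op n)) (colimit.isColimit G)) p
    exact ⟨i.down, p', rfl⟩
  · intro Z z hz
    let c : Cocone G :=
      { pt := Z
        ι := { app := fun i => z i.down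
               naturality := fun i j φ => (hz (homOfLE (have h : i ≤ j := leOfHom φ; h))).trans
                (Category.comp_id _).symm } }
    exact ⟨colimit.desc G c, fun i => colimit.ι_desc c ⟨i⟩⟩

/-- A lax cocone of types on a sequence has a limit type along a nonprincipal ultrafilter. -/
lemma exists_limit_type (F : ℕ ⥤ Cᵒᵖ ⥤ Type v) (r : ∀ i, XType (F.obj i) R) :
    ∃ ρ : ∀ i, XType (F.obj i) R, (∀ {i j : ℕ} (φ : i ⟶ j), F.map φ ≫ ρ j = ρ i) ∧
      ∀ (i : ℕ) {n : C} (p : (F.obj i).obj (op n)), Filter.Tendsto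
        (fun k => (r (max i k)).val ((F.map (homOfLE (le_max_left i k))).app (op n) p))
        (Filter.hyperfilter ℕ) (nhds ((ρ i).val p)) := by
  -- The index `max i k` is a stage to which `p` can be transported, and it equals `k` for large
  -- `k`.
  let seq : ∀ (i : ℕ) {n : C} (p : (F.obj i).obj (op n)) (k : ℕ), R.obj (op n) := fun i n p k =>
    (r (max i k)).val ((F.map (homOfLE (le_max_left i k))).app (op n) p)
  let lim : ∀ (i : ℕ) {n : C} (p : (F.obj i).obj (op n)), R.obj (op n) := fun i n p =>
    ((Filter.hyperfilter ℕ).map (seq i p)).lim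
  have hlim : ∀ (i : ℕ) {n : C} (p : (F.obj i).obj (op n)),
      Filter.Tendsto (seq i p) (Filter.hyperfilter ℕ) (nhds (lim i p)) := fun i n p =>
    ((Filter.hyperfilter ℕ).map (seq i p)).le_nhds_lim
  let ρ : ∀ i, XType (F.obj i) R := fun i => XType.mk (fun n p => lim i p) (by
    intro n m σ p
    refine tendsto_nhds_unique (hlim i _) ?_
    refine (((KOrd.map_continuous R σ).tendsto _).comp (hlim i p)).congr fun k => ?_
    show R.map σ.op ((r _).val _) = (r _).val _
    rw [app_map_apply, (r _).val_map])
  refine ⟨ρ, fun {i j} φ => XType.ext_val fun n p => ?_, fun i n p => hlim i p⟩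
  refine tendsto_nhds_unique (hlim j ((F.map φ).app (op n) p)) ((hlim i p).congr' ?_)
  -- Nonprincipality: beyond `j` the sequences started at `i` and at `j` coincide, so their limits
  -- do.
  have hev : ∀ᶠ k in (Filter.hyperfilter ℕ : Filter ℕ), j ≤ k :=
    Nat.hyperfilter_le_atTop (Filter.eventually_ge_atTop j)
  filter_upwards [hev] with k hk
  have key : ∀ {a b : ℕ} (f : i ⟶ a) (g : i ⟶ b), a = b →
      (r a).val ((F.map f).app (op n) p) = (r b).val ((F.map g).app (op n) p) := by
    rintro a _ f g rfl
    rw [Subsingleton.elim f g]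
  have h₁ := key (homOfLE (le_max_left i k)) (φ ≫ homOfLE (le_max_left j k)) (by
    rw [max_eq_right hk, max_eq_right ((leOfHom φ).trans hk)])
  rw [F.map_comp] at h₁
  exact h₁

/-- An ind-object with a type of `R`. -/
structure IndType (R : Cᵒᵖ ⥤ KOrd.{v}) where
  carrier : Cᵒᵖ ⥤ Type v
  isInd : IsIndObject carrier
  type : XType carrier R

/-- Every type on an ind-object extends, up to the order, to one whose values are limits of
approximations for which all solvable problems have a solution. -/
theorem exists_saturated [EssentiallySmall.{v} C] {X : Cᵒᵖ ⥤ Type v} (hX : IsIndObject X)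
    (r : XType X R) :
    ∃ (X' : Cᵒᵖ ⥤ Type v) (_ : IsIndObject X') (h : X ⟶ X') (r' : XType X' R),
      (∀ {n : C} (p : X.obj (op n)), r.val p ≤ r'.val (h.app (op n) p)) ∧
      ∀ {n : C} (p : X'.obj (op n)), ∃ A : Set (R.obj (op n)), r'.val p ∈ closure A ∧
        ∀ c ∈ A, c ≤ r'.val p ∧ ∀ {m : C} (σ : n ⟶ m) (Z : Set (R.obj (op m))), IsClosed Z →
          IsUpperSet Z → Solvable R σ c Z →
            ∃ q : X'.obj (op m), X'.map σ.op q = p ∧ r'.val q ∈ Z := by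
  have step : ∀ x : IndType R, ∃ (y : IndType R) (h : x.carrier ⟶ y.carrier),
      (∀ {n : C} (p : x.carrier.obj (op n)), x.type.val p ≤ y.type.val (h.app (op n) p)) ∧
      ∀ {n m : C} (σ : n ⟶ m) (p : x.carrier.obj (op n)) (Z : Set (R.obj (op m))), IsClosed Z →
        IsUpperSet Z → Solvable R σ (x.type.val p) Z →
          ∃ q : y.carrier.obj (op m), y.carrier.map σ.op q = h.app _ p ∧ y.type.val q ∈ Z := by
    rintro ⟨Y, hY, s⟩
    obtain ⟨Y', hY', h, s', h₁, h₂⟩ := exists_solve_all hY s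
    exact ⟨⟨Y', hY', s'⟩, h, h₁, h₂⟩
  choose next hom hle hsolve using step
  let x : ℕ → IndType R := fun i => Nat.rec ⟨X, hX, r⟩ (fun _ y => next y) i
  let F : ℕ ⥤ Cᵒᵖ ⥤ Type v := Functor.ofSequence (X := fun i => (x i).carrier)
    (fun i => hom (x i))
  let s : ∀ i, XType (F.obj i) R := fun i => (x i).type
  have hF : ∀ i, F.map (homOfLE (Nat.le_add_right i 1)) = hom (x i) :=
    Functor.ofSequence_map_homOfLE_succ _
  have hmono : ∀ {i j : ℕ} (φ : i ⟶ j) {n : C} (p : (F.obj i).obj (op n)),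
      (s i).val p ≤ (s j).val ((F.map φ).app (op n) p) := by
    intro i j φ n p
    obtain ⟨d, rfl⟩ := Nat.exists_eq_add_of_le (leOfHom φ)
    induction d with
    | zero =>
      rw [show φ = 𝟙 i from rfl, F.map_id]
      exact le_rfl
    | succ d ih =>
      refine (ih (homOfLE (Nat.le_add_right i d))).trans ?_
      rw [show φ = homOfLE (Nat.le_add_right i d) ≫ homOfLE (Nat.le_add_right (i + d) 1) from rfl,
        F.map_comp, hF]
      exact hle (x (i + d)) _
  obtain ⟨X', hX', ι, hι, hsurj, hdesc⟩ := exists_isIndObject_of_sequence F fun i => (x i).isInd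
  obtain ⟨ρ, hρ, hlim⟩ := exists_limit_type F s
  obtain ⟨r', hr'⟩ := hdesc (R ⋙ forget KOrd.{v}) ρ hρ
  have hval : ∀ (i : ℕ) {n : C} (p : (F.obj i).obj (op n)),
      XType.val (R := R) r' ((ι i).app (op n) p) = (ρ i).val p := by
    intro i n p
    rw [← hr' i]
    rfl
  have hιF : ∀ {i j : ℕ} (φ : i ⟶ j) {n : C} (p : (F.obj i).obj (op n)),
      (ι j).app (op n) ((F.map φ).app (op n) p) = (ι i).app (op n) p := by
    intro i j φ n p
    rw [← hι φ]
    rfl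
  have hsρ : ∀ (i : ℕ) {n : C} (p : (F.obj i).obj (op n)),
      (s i).val p ≤ XType.val (R := R) r' ((ι i).app (op n) p) := by
    intro i n p
    rw [hval]
    exact ge_of_tendsto' (hlim i p) fun k => hmono _ p
  refine ⟨X', hX', ι 0, r', hsρ 0, fun {n} p => ?_⟩
  -- The approximations are the values at all finite stages of all representatives of `p`.
  refine ⟨{c | ∃ (i : ℕ) (p' : (F.obj i).obj (op n)), (ι i).app (op n) p' = p ∧ (s i).val p' = c},
    ?_, ?_⟩
  · obtain ⟨i, p', rfl⟩ := hsurj p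
    rw [hval]
    exact mem_closure_of_tendsto (hlim i p') (Filter.Eventually.of_forall fun k =>
      ⟨max i k, _, hιF _ p', rfl⟩)
  · rintro c ⟨i, p', rfl, rfl⟩
    refine ⟨hsρ i p', fun {m} σ Z hZ hZ' hs => ?_⟩
    obtain ⟨q, hq, hqZ⟩ := hsolve (x i) σ p' Z hZ hZ' hs
    -- The problem was solved one stage later, and its condition is an up-set, so the limit value
    -- still satisfies it.
    refine ⟨(ι (i + 1)).app (op m) q, ?_, hZ' (hsρ (i + 1) q) hqZ⟩
    refine (app_map_apply (ι (i + 1)) σ q).symm.trans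
      ((congrArg ((ι (i + 1)).app (op n)) hq).trans ?_)
    rw [← hF]
    exact hιF _ p'

end Chain
end Polyadic

/-! ### The lax pullback -/

namespace KOrd

/-- Pairs `(a, b)` with `ψ b ≤ φ a`, where `A` carries the discrete order. -/
def LaxPair {A B D : KOrd.{w}} (φ : A ⟶ D) (ψ : B ⟶ D) : Type w :=
  {ab : A × B // ψ ab.2 ≤ φ ab.1}

namespace LaxPair

variable {A B D : KOrd.{w}} (φ : A ⟶ D) (ψ : B ⟶ D)

instance : TopologicalSpace (LaxPair φ ψ) :=
  inferInstanceAs (TopologicalSpace {ab : A × B // ψ ab.2 ≤ φ ab.1})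

lemma continuous_val : Continuous (Subtype.val : LaxPair φ ψ → A × B) :=
  continuous_subtype_val

instance : CompactSpace (LaxPair φ ψ) :=
  isCompact_iff_compactSpace.1 (IsClosed.isCompact (isClosed_le
    (ψ.hom'.continuous_toFun.comp continuous_snd) (φ.hom'.continuous_toFun.comp continuous_fst)))

instance : PartialOrder (LaxPair φ ψ) where
  le s t := s.1.1 = t.1.1 ∧ s.1.2 ≤ t.1.2
  le_refl _ := ⟨rfl, le_rfl⟩
  le_trans _ _ _ h h' := ⟨h.1.trans h'.1, h.2.trans h'.2⟩
  le_antisymm _ _ h h' := Subtype.ext (Prod.ext h.1 (le_antisymm h.2 h'.2))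

instance : OrderClosedTopology (LaxPair φ ψ) where
  isClosed_le' := by
    have h₁ : Continuous fun q : LaxPair φ ψ × LaxPair φ ψ => q.1.1 :=
      (continuous_val φ ψ).comp continuous_fst
    have h₂ : Continuous fun q : LaxPair φ ψ × LaxPair φ ψ => q.2.1 :=
      (continuous_val φ ψ).comp continuous_snd
    exact (isClosed_eq (continuous_fst.comp h₁) (continuous_fst.comp h₂)).inter
      (isClosed_le (continuous_snd.comp h₁) (continuous_snd.comp h₂))

end LaxPair

end KOrd

namespace Polyadic
variable {C : Type u} [Category.{v} C] {S P Q : Cᵒᵖ ⥤ KOrd.{w}}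

section LaxPullback

/-- The presheaf of pairs `(a, b)` of elements of `Q` and `S` with `f b ≤ g a`, the first component
being ordered by equality. -/
def laxPullback (f : S ⟶ P) (g : Q ⟶ P) : Cᵒᵖ ⥤ KOrd.{w} where
  obj n := KOrd.of (KOrd.LaxPair (g.app n) (f.app n))
  map {n m} σ := ⟨
    { toFun := fun s => ⟨(Q.map σ s.1.1, S.map σ s.1.2), by
        have h₁ := KOrd.app_map f σ.unop s.1.2
        have h₂ := KOrd.app_map g σ.unop s.1.1
        exact (h₁.trans_le (KOrd.map_mono P σ.unop s.2)).trans_eq h₂.symm⟩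
      monotone' := fun s t h => ⟨congrArg (fun a => Q.map σ a) h.1, KOrd.map_mono S σ.unop h.2⟩
      continuous_toFun := by
        have h := KOrd.LaxPair.continuous_val (g.app n) (f.app n)
        exact Continuous.subtype_mk
          (((KOrd.map_continuous Q σ.unop).comp (continuous_fst.comp h)).prodMk
            ((KOrd.map_continuous S σ.unop).comp (continuous_snd.comp h))) _ }⟩
  map_id n := by
    apply KOrd.Hom.ext
    ext s
    exact Subtype.ext (Prod.ext (KOrd.map_id_apply Q (n := n.unop) s.1.1)
      (KOrd.map_id_apply S (n := n.unop) s.1.2))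
  map_comp σ ρ := by
    apply KOrd.Hom.ext
    ext s
    exact Subtype.ext (Prod.ext (KOrd.map_comp_apply Q ρ.unop σ.unop s.1.1).symm
      (KOrd.map_comp_apply S ρ.unop σ.unop s.1.2).symm)

variable (f : S ⟶ P) (g : Q ⟶ P)

/-- The element of the lax pullback given by a pair. -/
def laxPair {n : C} (a : Q.obj (op n)) (b : S.obj (op n)) (h : f.app (op n) b ≤ g.app (op n) a) :
    (laxPullback f g).obj (op n) :=
  (⟨(a, b), h⟩ : KOrd.LaxPair (g.app (op n)) (f.app (op n)))

variable {f g}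

/-- The first component of an element of the lax pullback. -/
def laxFst {n : C} (s : (laxPullback f g).obj (op n)) : Q.obj (op n) :=
  Prod.fst (Subtype.val (p := fun ab : Q.obj (op n) × S.obj (op n) =>
    f.app (op n) ab.2 ≤ g.app (op n) ab.1) s)

/-- The second component of an element of the lax pullback. -/
def laxSnd {n : C} (s : (laxPullback f g).obj (op n)) : S.obj (op n) :=
  Prod.snd (Subtype.val (p := fun ab : Q.obj (op n) × S.obj (op n) =>
    f.app (op n) ab.2 ≤ g.app (op n) ab.1) s)

lemma lax_condition {n : C} (s : (laxPullback f g).obj (op n)) :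
    f.app (op n) (laxSnd s) ≤ g.app (op n) (laxFst s) :=
  Subtype.property (p := fun ab : Q.obj (op n) × S.obj (op n) =>
    f.app (op n) ab.2 ≤ g.app (op n) ab.1) s

lemma laxPullback_le_iff {n : C} {s t : (laxPullback f g).obj (op n)} :
    s ≤ t ↔ laxFst s = laxFst t ∧ laxSnd s ≤ laxSnd t :=
  Iff.rfl

lemma laxFst_map {n m : C} (σ : n ⟶ m) (s : (laxPullback f g).obj (op m)) :
    laxFst ((laxPullback f g).map σ.op s) = Q.map σ.op (laxFst s) :=
  rfl

lemma continuous_laxFst {n : C} :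
    Continuous (fun s : (laxPullback f g).obj (op n) => laxFst s) :=
  continuous_fst.comp (KOrd.LaxPair.continuous_val (g.app (op n)) (f.app (op n)))

lemma continuous_laxSnd {n : C} :
    Continuous (fun s : (laxPullback f g).obj (op n) => laxSnd s) :=
  continuous_snd.comp (KOrd.LaxPair.continuous_val (g.app (op n)) (f.app (op n)))

end LaxPullback

/-! ### Solvable demands in the lax pullback -/

section Solvability

lemma Bounded.exists_le_eq {A B : Type*} [Preorder A] [LE B] {φ : A → B} (h : Bounded φ) {a : A}
    {b : B} (hab : φ a ≤ b) : ∃ a', a ≤ a' ∧ φ a' = b :=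
  h (Set.Ici a) (isUpperSet_Ici a) hab ⟨a, le_rfl, rfl⟩

variable {f : S ⟶ P} {g : Q ⟶ P}

/-- Boundedness of `f` raises the `S`-component until the inequality becomes an equality. -/
lemma solvable_eq (hf : IsIntuitionistic f) {n : C} (c : (laxPullback f g).obj (op n)) :
    Solvable (laxPullback f g) (𝟙 n) c
      {s | f.app (op n) (laxSnd s) = g.app (op n) (laxFst s)} := by
  intro k a s _
  obtain ⟨v, hv, hv'⟩ := Bounded.exists_le_eq (hf.bounded k) (lax_condition s)
  refine ⟨k, 𝟙 k, a, IsPushout.of_vert_isIso ⟨by simp⟩, laxPair f g (laxFst s) v hv'.le, ?_, ?_⟩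
  · rw [KOrd.map_id_apply]
    exact laxPullback_le_iff.2 ⟨rfl, hv⟩
  · show f.app _ (S.map a.op v) = g.app _ (Q.map a.op (laxFst s))
    rw [KOrd.app_map, KOrd.app_map, hv']

variable [Limits.HasPushouts C]

/-- Interpolation in `Q` meets the demand, and boundedness corrects the result to lie exactly over
the given `Q`-component, as the discrete order requires. The second interpolation property of `f`
then supplies a matching `S`-component. -/
lemma solvable_le_fst (hQ : IsPolyadic Q) (hf : IsIntuitionistic f) {n m : C}
    (σ : n ⟶ m) (c : (laxPullback f g).obj (op n)) (t : Q.obj (op m))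
    (ht : Q.map σ.op t ≤ laxFst c) :
    Solvable (laxPullback f g) σ c {s | t ≤ laxFst s} := by
  intro k a s hs
  have sq := IsPushout.of_hasPushout a σ
  obtain ⟨hs₁, -⟩ := laxPullback_le_iff.1 hs
  obtain ⟨w, hw₁, hw₂⟩ := hQ.interpolation sq.flip t (laxFst s) (by
    rw [laxFst_map] at hs₁
    rwa [← hs₁])
  obtain ⟨u, hwu, hu⟩ := Bounded.exists_le_eq (hQ.bounded _) hw₂
  obtain ⟨v, hv₁, hv₂⟩ := hf.interpolation (Limits.pushout.inl a σ) (laxSnd s) (g.app _ u) (by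
    rw [← KOrd.app_map, hu]
    exact lax_condition s)
  exact ⟨_, _, _, sq, laxPair f g u v hv₂, laxPullback_le_iff.2 ⟨hu.symm, hv₁⟩,
    hw₁.trans (KOrd.map_mono Q _ hwu)⟩

/-- The `S`-component is chosen exactly over the given one, so that `f` of it still restricts below
`g` of the `Q`-component. Interpolation for `g` and boundedness of `Q` then produce a `Q`-component
over the given one. -/
lemma solvable_le_snd (hS : IsPolyadic S) (hQ : IsPolyadic Q) (hg : IsPolyadicMorphism g) {n m : C}
    (σ : n ⟶ m) (c : (laxPullback f g).obj (op n)) (t : S.obj (op m))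
    (ht : S.map σ.op t ≤ laxSnd c) :
    Solvable (laxPullback f g) σ c {s | t ≤ laxSnd s} := by
  intro k a s hs
  have sq := IsPushout.of_hasPushout a σ
  obtain ⟨-, hs₂⟩ := laxPullback_le_iff.1 hs
  obtain ⟨w, hw₁, hw₂⟩ := hS.interpolation sq.flip t (laxSnd s) (ht.trans hs₂)
  obtain ⟨v, hwv, hv⟩ := Bounded.exists_le_eq (hS.bounded _) hw₂
  obtain ⟨x, hx₁, hx₂⟩ := hg (Limits.pushout.inl a σ) (f.app _ v) (laxFst s) (by
    rw [← KOrd.app_map, hv]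
    exact lax_condition s)
  obtain ⟨u, hxu, hu⟩ := Bounded.exists_le_eq (hQ.bounded _) hx₂
  exact ⟨_, _, _, sq, laxPair f g u v (hx₁.trans (KOrd.app_mono g hxu)),
    laxPullback_le_iff.2 ⟨hu.symm, hv.ge⟩, hw₁.trans (KOrd.map_mono S _ hwv)⟩

end Solvability

end Polyadic

/-! ### Proof of the proposition -/

theorem mainTheorem7 {C : Type u} [Category.{v} C] [EssentiallySmall.{v} C] [Limits.HasPushouts C]
    {S P Q : Cᵒᵖ ⥤ KOrd.{v}}
    (hS : Polyadic.IsPolyadic S) (hP : Polyadic.IsPolyadic P) (hQ : Polyadic.IsPolyadic Q)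
    (hSopen : Polyadic.IsOpenSpace S)
    (f : S ⟶ P) (hf : Polyadic.IsIntuitionistic f)
    (g : Q ⟶ P) (hg : Polyadic.IsPolyadicMorphism g)
    {X : Cᵒᵖ ⥤ Type v} (hX : Limits.IsIndObject X)
    (u : Polyadic.XType X Q) (v : Polyadic.XType X S)
    (hsq : (v.push f).Le (u.push g)) :
    ∃ (X' : Cᵒᵖ ⥤ Type v) (_ : Limits.IsIndObject X') (h : X ⟶ X')
      (u' : Polyadic.XType X' Q) (v' : Polyadic.XType X' S),
      Polyadic.IsModel v' ∧
      Polyadic.IsOmegaSaturatedModel u' ∧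
      (Polyadic.IsOpenSpace Q → Polyadic.IsModel u') ∧
      u'.push g = v'.push f ∧
      h ≫ u' = u ∧
      v.Le (h ≫ v') := by
  open Polyadic in
  let R := laxPullback f g
  let r : XType X R := XType.mk (fun n p => laxPair f g (u.val p) (v.val p) (hsq n p))
    (fun σ p => Subtype.ext (Prod.ext (u.val_map σ p) (v.val_map σ p)))
  obtain ⟨X', hX', h, r', hr, hsat⟩ := exists_saturated hX r
  let u' : XType X' Q := XType.mk (fun n p => laxFst (r'.val p))
    (fun σ p => congrArg laxFst (r'.val_map σ p))
  let v' : XType X' S := XType.mk (fun n p => laxSnd (r'.val p))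
    (fun σ p => congrArg laxSnd (r'.val_map σ p))
  have hu' : IsOmegaSaturatedModel u' := by
    intro n m σ t p ht
    obtain ⟨A, hA, hA'⟩ := hsat p
    -- Any approximation will do: its `Q`-component is already that of the limit.
    obtain ⟨c, hc⟩ := closure_nonempty_iff.1 ⟨_, hA⟩
    obtain ⟨hcp, hc'⟩ := hA' c hc
    obtain ⟨q, hq, hqt⟩ := hc' σ {s | t ≤ laxFst s} (isClosed_Ici.preimage continuous_laxFst)
      (fun a b hab (ha : t ≤ laxFst a) => ha.trans (laxPullback_le_iff.1 hab).1.le)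
      (solvable_le_fst hQ hf σ c t (ht.trans (laxPullback_le_iff.1 hcp).1.ge))
    exact ⟨q, hqt, hq⟩
  refine ⟨X', hX', h, u', v', ?_, hu', ?_, ?_, ?_, ?_⟩
  · refine isModel_of_open hSopen v' ?_
    intro n m σ p U hU hU' hp
    obtain ⟨A, hA, hA'⟩ := hsat p
    -- Openness of `S` makes the image of `U` a neighbourhood of the value at `p`, so an
    -- approximation lies in it. For that approximation the demand given by `t` is solvable.
    obtain ⟨c, ⟨t, htU, htc⟩, hc⟩ := mem_closure_iff.1 hA _
      ((hSopen σ U hU hU').1.preimage continuous_laxSnd) hp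
    obtain ⟨-, hc'⟩ := hA' c hc
    obtain ⟨q, hq, hqt⟩ := hc' σ {s | t ≤ laxSnd s} (isClosed_Ici.preimage continuous_laxSnd)
      (fun a b hab (ha : t ≤ laxSnd a) => ha.trans (laxPullback_le_iff.1 hab).2)
      (solvable_le_snd hS hQ hg σ c t htc.le)
    exact ⟨q, hq, hU' hqt htU⟩
  · intro hQopen
    refine isModel_of_open hQopen u' ?_
    rintro n m σ p U hU hU' ⟨t, htU, htp⟩
    obtain ⟨q, hqt, hq⟩ := hu' σ t p (le_of_eq htp)
    exact ⟨q, hq, hU' hqt htU⟩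
  · refine XType.ext_val fun n p => ?_
    obtain ⟨A, hA, hA'⟩ := hsat p
    obtain ⟨c, hc⟩ := closure_nonempty_iff.1 ⟨_, hA⟩
    obtain ⟨q, hq, hqt⟩ := (hA' c hc).2 (𝟙 n)
      {s | f.app (op n) (laxSnd s) = g.app (op n) (laxFst s)}
      (isClosed_eq ((KOrd.app_continuous f n).comp continuous_laxSnd)
        ((KOrd.app_continuous g n).comp continuous_laxFst))
      -- Equality defines an up-set: raising the `S`-component under a fixed `Q`-component leaves
      -- `f` of it between `g a` and `g a`.
      (fun a b hab (ha : f.app (op n) (laxSnd a) = g.app (op n) (laxFst a)) =>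
        le_antisymm (lax_condition b) (by
          rw [← (laxPullback_le_iff.1 hab).1, ← ha]
          exact KOrd.app_mono f (laxPullback_le_iff.1 hab).2))
      (solvable_eq hf c)
    have hqp : q = p := by simpa using hq
    rw [← hqp]
    exact hqt.symm
  · exact XType.ext_val fun n p => (laxPullback_le_iff.1 (hr p)).1.symm
  · exact fun n p => (laxPullback_le_iff.1 (hr p)).2
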